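/- Let $m$ balls be thrown into $n\ge 1$ bins, i.e. let $c_1,\dots,c_m$ be independent and uniformly distributed on $\{1,\dots,n\}$, let $X_i=|\{j : c_j=i\}|$ be the load of bin $i$, and for an integer $d\ge 0$ let $P_d(m,n)=\Pr[\min_{1\le i\le n}X_i\ge d]$. (i) Let $d\ge 0$ be an integer and $\alpha>d$ a real number. For $\lambda>0$ put $\zeta=\zeta(\lambda)=\sum_{i\ge d}\lambda^{i-d}/i!$ and let $Z$ be a Poisson random variable truncated to values $\ge d$, i.e. $\Pr[Z=i]=\frac1\zeta\frac{\lambda^{i-d}}{i!}$ for $i\ge d$ and $\Pr[Z=i]=0$ for $i<d$. There is exactly one $\lambda>0$ for which $\mathbb E[Z]=\alpha$. For this $\lambda$ and $$b=\frac{\alpha^\alpha\,\zeta}{e^{\alpha}\,\lambda^{\alpha-d}}$$ there are constants $c,C>0$, depending only on $\alpha$ and $d$, such that for all $n\ge1$ $$c\,b^n\le P_d(\lfloor\alpha n\rfloor,n)\le C\,b^n ,$$ where of course $\lfloor\alpha n\rfloor=\alpha n$ whenever $\alpha n$ is an integer. For example, for $\alpha=2$ and $d=1$ one has $|b-0.836|<0.0005$.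 (ii) There are absolute constants $c,C>0$ such that for all integers $d\ge1$ and $n\ge1$ $$c\,b^n\sqrt{dn}\le P_d(dn,n)\le C\,b^n\sqrt{dn},\qquad b=\frac{d^d}{e^d\,d!}.$$ -/

import Mathlib

open MeasureTheory ProbabilityTheory

noncomputable section

namespace BallsIntoBins

/-- The joint law of the bins `c₁, …, cₘ` chosen by `m` balls: independent, each uniformly
distributed over the `n` bins. -/
def throwLaw (m n : ℕ) : Measure (Fin m → Fin n) :=
  Measure.pi fun _ : Fin m => uniformOn (Set.univ : Set (Fin n))

/-- The load of bin `i`: the number of balls `j` with `c j = i`. -/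
def load {m n : ℕ} (c : Fin m → Fin n) (i : Fin n) : ℕ :=
  (Finset.univ.filter fun j : Fin m => c j = i).card

/-- The event that every bin receives at least `d` balls. -/
def allLoaded (m n d : ℕ) : Set (Fin m → Fin n) :=
  {c | ∀ i : Fin n, d ≤ load c i}

/-- The probability that throwing `m` balls into `n` bins puts at least `d` balls into every
bin. -/
def probAllLoaded (m n d : ℕ) : ℝ :=
  (throwLaw m n).real (allLoaded m n d)

/-- The unnormalised weights of the truncated Poisson distribution. -/
def truncWeight (d : ℕ) (lam : ℝ) (i : ℕ) : ℝ :=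
  if i < d then 0 else lam ^ (i - d) / (i.factorial : ℝ)

/-- The normalisation factor `ζ = ∑_{i ≥ d} λ^(i-d) / i!`. -/
def zeta (d : ℕ) (lam : ℝ) : ℝ :=
  ∑' i : ℕ, truncWeight d lam i

/-- The probability mass function of the Poisson distribution with parameter `λ > 0`,
truncated to values `≥ d`. -/
def truncPoisson (d : ℕ) (lam : ℝ) (i : ℕ) : ℝ :=
  truncWeight d lam i / zeta d lam

/-- `λ > 0` is tuned such that the Poisson distribution truncated to values `≥ d` has
expectation `α`. -/
def IsTuned (α : ℝ) (d : ℕ) (lam : ℝ) : Prop :=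
  0 < lam ∧ HasSum (fun i : ℕ => (i : ℝ) * truncPoisson d lam i) α

/-- The base `b = α^α ζ / (e^α λ^(α-d))`. -/
def base (α : ℝ) (d : ℕ) (lam : ℝ) : ℝ :=
  α ^ α * zeta d lam / (Real.exp α * lam ^ (α - (d : ℝ)))

/-- The base `b = d^d / (e^d d!)` of the case `α = d`. -/
def baseExact (d : ℕ) : ℝ :=
  (d : ℝ) ^ d / (Real.exp (d : ℝ) * (d.factorial : ℝ))

end BallsIntoBins

end

/-! Let F(x) = ∑_j x^j/(j+d)!. Throws with prescribed loads are counted by multinomials, so P_d(m,n)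
= m!/n^m · [x^(m-dn)] F(x)^n (`probAllLoaded_eq`).

Substituting λx and dividing by ζ turns F into the probability generating function of Z - d
(`coeff_loadSeries_pow`). Hence [x^k] F^n = ζ^n λ^(-k) Pr[S_n = k], where S_n is a sum of n
independent copies of Z - d. The tuning E[Z] = α places k = ⌊αn⌋ - dn within 1 of the mean of S_n,
so a local limit theorem (`tendsto_sqrt_mul_coeff_pow`) makes Pr[S_n = k] of order 1/√n. Stirling's
formula contributes √m (m/e)^m. As m/n stays bounded, √m cancels 1/√n, and the exponential factors
make up b^n up to a bounded rounding error.

If m = dn, only the constant coefficient (1/d!)^n is involved. There is no 1/√n to cancel, so the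
Stirling factor √(dn) survives, with constants uniform in d and n.

The tuned λ exists by the intermediate value theorem and is unique because the centred weights
change sign only once. -/

open MeasureTheory ProbabilityTheory Filter Topology

namespace BallsIntoBins

/-! ### The occupancy probability as a power series coefficient -/

/-- The exponential generating function of the loads `≥ d`, divided by `X ^ d`. -/
noncomputable def loadSeries (d : ℕ) : PowerSeries ℝ :=
  PowerSeries.mk fun j => ((j + d).factorial : ℝ)⁻¹

/-- The number of ways to distribute `m` balls with prescribed loads `k` is multinomial. -/
theorem card_load_eq_multinomial {m n : ℕ} (k : Fin n → ℕ) (hk : ∑ i, k i = m) :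
    (Finset.univ.filter fun c : Fin m → Fin n => load c = k).card
      = Nat.multinomial Finset.univ k := by
  classical
  -- The power (∑ X_i)^m is expanded in two ways, over all throws and by the multinomial theorem;
  -- the coefficients of the monomial with exponents k are then compared.
  have h₁ : (∑ i : Fin n, (MvPolynomial.X i : MvPolynomial (Fin n) ℕ)) ^ m
      = ∑ c : Fin m → Fin n, MvPolynomial.monomial (Finsupp.equivFunOnFinite.symm (load c)) 1 := by
    rw [Finset.sum_pow']
    simp only [Fintype.piFinset_univ]
    refine Finset.sum_congr rfl fun c _ => ?_
    rw [← Finset.prod_fiberwise (s := Finset.univ) (g := c)]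
    have : ∀ i : Fin n, ∏ j ∈ Finset.univ.filter (fun j => c j = i),
        (MvPolynomial.X (c j) : MvPolynomial (Fin n) ℕ) = MvPolynomial.X i ^ load c i := by
      intro i
      rw [Finset.prod_congr rfl (g := fun _ => MvPolynomial.X i)]
      · simp [load]
      · intro j hj; rw [(Finset.mem_filter.1 hj).2]
    simp_rw [this]
    rw [MvPolynomial.prod_X_pow]
    congr 2
    ext i; simp
  have h₂ := Finset.sum_pow_eq_sum_piAntidiag (Finset.univ)
    (fun i : Fin n => (MvPolynomial.X i : MvPolynomial (Fin n) ℕ)) m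
  rw [h₁] at h₂
  have h₃ := congrArg (MvPolynomial.coeff (Finsupp.equivFunOnFinite.symm k)) h₂
  rw [MvPolynomial.coeff_sum, MvPolynomial.coeff_sum] at h₃
  simp only [MvPolynomial.coeff_monomial] at h₃
  rw [Finset.card_filter]
  simp only [EmbeddingLike.apply_eq_iff_eq] at h₃
  rw [h₃, Finset.sum_eq_single k]
  · rw [← map_natCast (MvPolynomial.C (σ := Fin n) (R := ℕ)), MvPolynomial.coeff_C_mul,
      MvPolynomial.coeff_prod_X_pow, if_pos]
    · simp
    · ext i; simp
  · intro k' _ hne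
    rw [← map_natCast (MvPolynomial.C (σ := Fin n) (R := ℕ)), MvPolynomial.coeff_C_mul,
      MvPolynomial.coeff_prod_X_pow, if_neg]
    · simp
    · intro h
      apply hne
      ext i
      simpa using (DFunLike.congr_fun h i).symm
  · intro h
    exact absurd (by simp [hk]) h

theorem sum_load {m n : ℕ} (c : Fin m → Fin n) : ∑ i, load c i = m := by
  simpa [load] using (Finset.card_eq_sum_card_fiberwise (s := Finset.univ) (t := Finset.univ)
    (f := c) (by simp)).symm

theorem coeff_X_pow_mul_loadSeries (d i : ℕ) :
    PowerSeries.coeff i (PowerSeries.X ^ d * loadSeries d)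
      = if d ≤ i then ((i.factorial : ℝ))⁻¹ else 0 := by
  rw [PowerSeries.coeff_X_pow_mul']
  split_ifs with h
  · simp [loadSeries, Nat.sub_add_cancel h]
  · rfl

/-- Grouping throws by load vector l, each admissible fibre has m!/∏ l_i! elements, which is m!
times one term of the expanded coefficient of the product; inadmissible l contribute zero on both
sides. -/
theorem card_allLoaded (m n d : ℕ) :
    ((Finset.univ.filter fun c : Fin m → Fin n => ∀ i, d ≤ load c i).card : ℝ)
      = m.factorial * PowerSeries.coeff m ((PowerSeries.X ^ d * loadSeries d) ^ n) := by
  classical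
  have hprod : (PowerSeries.X ^ d * loadSeries d) ^ n
      = ∏ _i : Fin n, (PowerSeries.X ^ d * loadSeries d) := by simp
  rw [hprod, PowerSeries.coeff_prod, Finset.mul_sum]
  have hfib := Finset.card_eq_sum_card_fiberwise
    (s := Finset.univ.filter fun c : Fin m → Fin n => ∀ i, d ≤ load c i)
    (t := Finset.finsuppAntidiag Finset.univ m)
    (f := fun c => Finsupp.equivFunOnFinite.symm (load c)) (by
      intro c _
      simp [sum_load])
  rw [hfib, Nat.cast_sum]
  refine Finset.sum_congr rfl fun l hl => ?_
  have hsum : ∑ i, l i = m := by simpa using hl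
  simp only [coeff_X_pow_mul_loadSeries]
  rw [Finset.filter_filter]
  by_cases hd : ∀ i, d ≤ l i
  · have : (Finset.univ.filter fun c : Fin m → Fin n => (∀ i, d ≤ load c i) ∧
        Finsupp.equivFunOnFinite.symm (load c) = l)
        = Finset.univ.filter fun c : Fin m → Fin n => load c = l := by
      ext c
      simp only [Finset.mem_filter, Finset.mem_univ, true_and, Equiv.symm_apply_eq]
      constructor
      · intro h; exact h.2
      · intro h; exact ⟨by rw [h]; exact hd, h⟩
    rw [this, card_load_eq_multinomial _ hsum]
    simp only [hd, if_true, Finset.prod_inv_distrib]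
    have hspec := Nat.multinomial_spec Finset.univ l
    rw [hsum] at hspec
    rw [← hspec]
    push_cast
    have : (∏ i, ((l i).factorial : ℝ)) ≠ 0 :=
      Finset.prod_ne_zero_iff.2 fun i _ => by positivity
    field_simp
  · have hempty : (Finset.univ.filter fun c : Fin m → Fin n => (∀ i, d ≤ load c i) ∧
        Finsupp.equivFunOnFinite.symm (load c) = l) = ∅ := by
      refine Finset.filter_false_of_mem fun c _ h => hd ?_
      rw [← h.2]
      exact h.1
    push Not at hd
    obtain ⟨i, hi⟩ := hd
    rw [hempty, Finset.prod_eq_zero (Finset.mem_univ i) (if_neg (by omega))]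
    simp

/-- The occupancy probability as a coefficient of a power of the generating function. -/
theorem probAllLoaded_eq {m n d : ℕ} (hm : d * n ≤ m) :
    probAllLoaded m n d
      = m.factorial / (n : ℝ) ^ m * PowerSeries.coeff (m - d * n) (loadSeries d ^ n) := by
  classical
  have hlaw : throwLaw m n = uniformOn (Set.univ : Set (Fin m → Fin n)) := by
    rw [throwLaw, ← uniformOn_pi, Set.pi_univ]
  have hset : allLoaded m n d
      = ((Finset.univ.filter fun c : Fin m → Fin n => ∀ i, d ≤ load c i : Finset _) : Set _) := by
    ext c; simp [allLoaded]
  have hcoeff := card_allLoaded m n d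
  rw [mul_pow, ← pow_mul, PowerSeries.coeff_X_pow_mul', if_pos hm] at hcoeff
  rw [probAllLoaded, Measure.real, hlaw, hset, ← Finset.coe_univ, uniformOn_apply_finset,
    Finset.univ_inter, ENNReal.toReal_div, ENNReal.toReal_natCast, hcoeff]
  simp
  ring

/-- Strict positivity for every n ≥ 1 is what later extends an asymptotic lower bound to small n. -/
theorem coeff_loadSeries_pow_pos (d : ℕ) {n : ℕ} (hn : 1 ≤ n) (k : ℕ) :
    0 < PowerSeries.coeff k (loadSeries d ^ n) := by
  induction n, hn using Nat.le_induction generalizing k with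
  | base => simp only [pow_one, loadSeries, PowerSeries.coeff_mk]; positivity
  | succ n hn ih =>
    rw [pow_succ, PowerSeries.coeff_mul]
    refine Finset.sum_pos (fun x _ => mul_pos (ih _) ?_) ⟨(0, k), by simp⟩
    simp only [loadSeries, PowerSeries.coeff_mk]; positivity

theorem probAllLoaded_pos {m n d : ℕ} (hn : 1 ≤ n) (hm : d * n ≤ m) :
    0 < probAllLoaded m n d := by
  rw [probAllLoaded_eq hm]
  have := coeff_loadSeries_pow_pos d hn (m - d * n)
  positivity

theorem probAllLoaded_exact (n d : ℕ) :
    probAllLoaded (d * n) n d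
      = (d * n).factorial / ((n : ℝ) ^ (d * n) * (d.factorial : ℝ) ^ n) := by
  rw [probAllLoaded_eq le_rfl, Nat.sub_self, PowerSeries.coeff_zero_eq_constantCoeff_apply,
    map_pow, ← PowerSeries.coeff_zero_eq_constantCoeff_apply]
  simp [loadSeries]
  ring

/-! ### Absolutely summable power series on the unit disc and Fourier inversion -/

section Fourier

open PowerSeries

theorem norm_exp_I_mul_ofReal (t : ℝ) : ‖Complex.exp (Complex.I * t)‖ = 1 := by
  rw [mul_comm, Complex.norm_exp_ofReal_mul_I]

theorem summable_coeff_mul {f g : PowerSeries ℝ} (hf : Summable fun k => ‖coeff k f‖)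
    (hg : Summable fun k => ‖coeff k g‖) : Summable fun k => ‖coeff k (f * g)‖ := by
  simp only [PowerSeries.coeff_mul]
  exact summable_norm_sum_mul_antidiagonal_of_summable_norm
    (f := fun k => coeff k f) (g := fun k => coeff k g) hf hg

theorem summable_coeff_pow {f : PowerSeries ℝ} (hf : Summable fun k => ‖coeff k f‖) (n : ℕ) :
    Summable fun k => ‖coeff k (f ^ n)‖ := by
  induction n with
  | zero =>
    refine summable_of_ne_finset_zero (s := {0}) fun k hk => ?_
    simp only [Finset.mem_singleton] at hk
    simp [coeff_one, hk]
  | succ n ih => rw [pow_succ]; exact summable_coeff_mul ih hf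

theorem summable_coeff_mul_pow {f : PowerSeries ℝ} (hf : Summable fun k => ‖coeff k f‖)
    {z : ℂ} (hz : ‖z‖ ≤ 1) : Summable fun k => ‖((coeff k f : ℝ) : ℂ) * z ^ k‖ := by
  refine hf.of_nonneg_of_le (fun k => norm_nonneg _) fun k => ?_
  rw [norm_mul, norm_pow, Complex.norm_real]
  exact mul_le_of_le_one_right (norm_nonneg _) (pow_le_one₀ (norm_nonneg _) hz)

theorem tsum_coeff_pow {f : PowerSeries ℝ} (hf : Summable fun k => ‖coeff k f‖)
    {z : ℂ} (hz : ‖z‖ ≤ 1) (n : ℕ) :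
    ∑' k, ((coeff k (f ^ n) : ℝ) : ℂ) * z ^ k = (∑' k, ((coeff k f : ℝ) : ℂ) * z ^ k) ^ n := by
  induction n with
  | zero =>
    rw [tsum_eq_single 0 fun k hk => by simp [coeff_one, hk]]
    simp
  | succ n ih =>
    rw [pow_succ (∑' k, ((coeff k f : ℝ) : ℂ) * z ^ k), ← ih,
      tsum_mul_tsum_eq_tsum_sum_antidiagonal_of_summable_norm
        (f := fun k => ((coeff k (f ^ n) : ℝ) : ℂ) * z ^ k)
        (g := fun k => ((coeff k f : ℝ) : ℂ) * z ^ k)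
        (summable_coeff_mul_pow (summable_coeff_pow hf n) hz) (summable_coeff_mul_pow hf hz)]
    refine tsum_congr fun k => ?_
    rw [pow_succ, PowerSeries.coeff_mul]
    push_cast
    rw [Finset.sum_mul]
    refine Finset.sum_congr rfl fun x hx => ?_
    rw [← Finset.HasAntidiagonal.mem_antidiagonal.1 hx, pow_add]
    ring

theorem integral_exp_int_mul_I (k : ℤ) :
    ∫ t in -Real.pi..Real.pi, Complex.exp (k * Complex.I * t)
      = if k = 0 then (2 * Real.pi : ℂ) else 0 := by
  split_ifs with hk
  · subst hk
    simp
    ring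
  · have hc : (k : ℂ) * Complex.I ≠ 0 := mul_ne_zero (by exact_mod_cast hk) Complex.I_ne_zero
    rw [integral_exp_mul_complex hc]
    have : Complex.exp (k * Complex.I * (Real.pi : ℝ))
        = Complex.exp (k * Complex.I * ((-Real.pi : ℝ) : ℂ)) := by
      rw [Complex.exp_eq_exp_iff_exists_int]
      exact ⟨k, by push_cast; ring⟩
    rw [this, sub_self, zero_div]

/-- Fourier inversion for absolutely summable coefficients. -/
theorem integral_tsum_mul_exp {a : ℕ → ℝ} (ha : Summable fun k => ‖a k‖) (m : ℕ) :
    ∫ t in -Real.pi..Real.pi, (∑' k, (a k : ℂ) * Complex.exp (Complex.I * t) ^ k)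
        * Complex.exp (-(m * Complex.I * t)) = 2 * Real.pi * a m := by
  have h := intervalIntegral.hasSum_integral_of_dominated_convergence
    (μ := volume) (a := -Real.pi) (b := Real.pi)
    (F := fun k (t : ℝ) => (a k : ℂ) * Complex.exp (Complex.I * t) ^ k
        * Complex.exp (-(m * Complex.I * t)))
    (f := fun t : ℝ => (∑' k, (a k : ℂ) * Complex.exp (Complex.I * t) ^ k)
        * Complex.exp (-(m * Complex.I * t)))
    (fun k _ => ‖a k‖)
    (fun k => (Continuous.aestronglyMeasurable (by fun_prop)))
    (fun k => ae_of_all _ fun t _ => by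
      have h2 : ‖Complex.exp (-(m * Complex.I * t))‖ = 1 := by
        rw [show -((m : ℂ) * Complex.I * t) = ((-(m * t) : ℝ) : ℂ) * Complex.I by push_cast; ring,
          Complex.norm_exp_ofReal_mul_I]
      rw [norm_mul, norm_mul, norm_pow, norm_exp_I_mul_ofReal, h2, one_pow, mul_one, mul_one, Complex.norm_real])
    (ae_of_all _ fun t _ => ha)
    intervalIntegrable_const
    (ae_of_all _ fun t _ => by
      have hsum : Summable fun k => (a k : ℂ) * Complex.exp (Complex.I * t) ^ k := by
        refine Summable.of_norm (ha.congr fun k => ?_)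
        rw [norm_mul, norm_pow, norm_exp_I_mul_ofReal, one_pow, mul_one, Complex.norm_real]
      exact hsum.hasSum.mul_right _)
  rw [← h.tsum_eq]
  have hterm : ∀ k : ℕ, (∫ t in -Real.pi..Real.pi, (a k : ℂ) * Complex.exp (Complex.I * t) ^ k
        * Complex.exp (-(m * Complex.I * t))) = if k = m then 2 * Real.pi * (a m : ℂ) else 0 := by
    intro k
    have : ∀ t : ℝ, (a k : ℂ) * Complex.exp (Complex.I * t) ^ k
        * Complex.exp (-(m * Complex.I * t))
        = (a k : ℂ) * Complex.exp (((k - m : ℤ) : ℂ) * Complex.I * t) := by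
      intro t
      rw [← Complex.exp_nat_mul, mul_assoc, ← Complex.exp_add]
      congr 2
      push_cast; ring
    simp_rw [this]
    rw [intervalIntegral.integral_const_mul, integral_exp_int_mul_I]
    by_cases hkm : k = m
    · subst hkm; simp; ring
    · have : ((k : ℤ) - m) ≠ 0 := by omega
      simp [hkm, this]
  simp_rw [hterm]
  rw [tsum_ite_eq]

end Fourier

/-! ### Characteristic functions and the local limit theorem -/

section LocalLimit

/-- The characteristic function of a mass function on `ℕ`. -/
noncomputable def charSeries (p : ℕ → ℝ) (t : ℝ) : ℂ :=
  ∑' k, (p k : ℂ) * Complex.exp (Complex.I * t) ^ k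

theorem continuous_charSeries {p : ℕ → ℝ} (hp : Summable fun k => ‖p k‖) :
    Continuous (charSeries p) := by
  refine continuous_tsum (fun k => by fun_prop) hp fun k t => ?_
  simp

theorem coeff_pow_eq_integral {p : ℕ → ℝ} (hp : Summable fun k => ‖p k‖) (n m : ℕ) :
    2 * Real.pi * ((PowerSeries.coeff m (PowerSeries.mk p ^ n) : ℝ) : ℂ)
      = ∫ t in -Real.pi..Real.pi, charSeries p t ^ n * Complex.exp (-(m * Complex.I * t)) := by
  have hs : Summable fun k => ‖PowerSeries.coeff k (PowerSeries.mk p)‖ := by simpa using hp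
  rw [← integral_tsum_mul_exp (summable_coeff_pow hs n) m]
  refine intervalIntegral.integral_congr fun t _ => ?_
  rw [tsum_coeff_pow hs (norm_exp_I_mul_ofReal t).le]
  simp [charSeries]

/-- The squared modulus is (x+y)² - 2xy(1 - cos t), and 1 - cos t ≥ 2t²/π² on [-π, π]. The
assumption x + y ≤ 1 allows passing to the square root. -/
theorem norm_add_mul_exp_le {x y t : ℝ} (hx : 0 < x) (hy : 0 < y) (hxy : x + y ≤ 1)
    (ht : |t| ≤ Real.pi) :
    ‖(x : ℂ) + y * Complex.exp (Complex.I * t)‖ ≤ x + y - 2 * x * y / Real.pi ^ 2 * t ^ 2 := by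
  have hcos := Real.cos_le_one_sub_mul_cos_sq ht
  have hsq : ‖(x : ℂ) + y * Complex.exp (Complex.I * t)‖ ^ 2
      = (x + y) ^ 2 - 2 * x * y * (1 - Real.cos t) := by
    rw [mul_comm Complex.I, Complex.exp_mul_I, ← Complex.ofReal_cos, ← Complex.ofReal_sin,
      Complex.sq_norm, Complex.normSq_apply]
    simp only [Complex.add_re, Complex.add_im,
      Complex.ofReal_re, Complex.ofReal_im, Complex.mul_re, Complex.mul_im, Complex.I_re,
      Complex.I_im]
    linear_combination y ^ 2 * Real.sin_sq_add_cos_sq t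
  have hpi := Real.pi_gt_three
  set q := 2 * x * y / Real.pi ^ 2 * t ^ 2 with hq
  have hq0 : 0 ≤ q := by positivity
  have ht2 : t ^ 2 ≤ Real.pi ^ 2 := by rw [← sq_abs]; gcongr
  have hq1 : q ≤ 2 * x * y := by
    rw [hq, div_mul_eq_mul_div, div_le_iff₀ (by positivity)]
    gcongr
  have hle : (x + y) ^ 2 - 2 * x * y * (1 - Real.cos t) ≤ (x + y) ^ 2 - 2 * q := by
    have : 2 * x * y * (2 / Real.pi ^ 2 * t ^ 2) ≤ 2 * x * y * (1 - Real.cos t) := by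
      gcongr; linarith
    have h2 : 2 * x * y * (2 / Real.pi ^ 2 * t ^ 2) = 2 * q := by rw [hq]; ring
    linarith
  refine abs_le_of_sq_le_sq' ?_ ?_ |>.2
  · rw [hsq]; nlinarith
  · nlinarith

/-- The masses at 0 and 1 alone force decay; the remaining mass is bounded trivially, and 1 - u ≤
e^(-u). The n-th power at s/√n is then dominated by a Gaussian independent of n. -/
theorem norm_charSeries_le {p : ℕ → ℝ} (hp : ∀ k, 0 ≤ p k) (hsum : HasSum p 1)
    (h0 : 0 < p 0) (h1 : 0 < p 1) {t : ℝ} (ht : |t| ≤ Real.pi) :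
    ‖charSeries p t‖ ≤ Real.exp (-(2 * p 0 * p 1 / Real.pi ^ 2 * t ^ 2)) := by
  have hn : ∀ k, ‖(p k : ℂ) * Complex.exp (Complex.I * t) ^ k‖ = p k := fun k => by
    simp [abs_of_nonneg (hp k)]
  have hs : Summable fun k => ‖(p k : ℂ) * Complex.exp (Complex.I * t) ^ k‖ := by
    simpa only [hn] using hsum.summable
  have htail : HasSum (fun k => p (k + 2)) (1 - (p 0 + p 1)) := by
    have := (hasSum_nat_add_iff' 2).2 hsum
    simpa [Finset.sum_range_succ] using this
  have hle1 : p 0 + p 1 ≤ 1 := by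
    have := htail.nonneg fun k => hp _
    linarith
  rw [charSeries, ← hs.of_norm.sum_add_tsum_nat_add 2]
  refine (norm_add_le _ _).trans ?_
  have htl : ‖∑' k, (p (k + 2) : ℂ) * Complex.exp (Complex.I * t) ^ (k + 2)‖
      ≤ 1 - (p 0 + p 1) := by
    refine tsum_of_norm_bounded htail fun k => (hn (k + 2)).le
  have hhd := norm_add_mul_exp_le h0 h1 hle1 ht
  have := Real.add_one_le_exp (-(2 * p 0 * p 1 / Real.pi ^ 2 * t ^ 2))
  simp only [Finset.sum_range_succ, Finset.sum_range_zero, pow_zero, mul_one, pow_one, zero_add]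
  linarith

/-- A quadratic bound valid for all real x, so that finite variance suffices for domination; for |x|
> 1 it is 2 + |x| ≤ 3x². -/
theorem norm_exp_I_sub_sub_le (x : ℝ) :
    ‖Complex.exp (Complex.I * x) - 1 - Complex.I * x‖ ≤ 3 * x ^ 2 := by
  rcases le_or_gt |x| 1 with h | h
  · have := Complex.norm_exp_sub_one_sub_id_le (x := Complex.I * x) (by simpa using h)
    refine this.trans ?_
    simp
    nlinarith [sq_nonneg x]
  · refine (norm_sub_le _ _).trans ?_
    have h1 := norm_sub_le (Complex.exp (Complex.I * x)) 1
    rw [norm_exp_I_mul_ofReal] at h1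
    simp at h1 ⊢
    rw [← sq_abs x]
    nlinarith

theorem tendsto_nat_mul_exp_sub (y : ℝ) :
    Tendsto (fun n : ℕ => (n : ℂ) * (Complex.exp (Complex.I * ((y / √n : ℝ) : ℂ)) - 1
      - Complex.I * ((y / √n : ℝ) : ℂ))) atTop (𝓝 (-(y ^ 2 / 2 : ℝ))) := by
  have hlim : Tendsto (fun n : ℕ => Complex.I * ((y / √n : ℝ) : ℂ)) atTop (𝓝 0) := by
    have h1 : Tendsto (fun n : ℕ => y / √(n : ℝ)) atTop (𝓝 0) :=
      tendsto_const_nhds.div_atTop (Real.tendsto_sqrt_atTop.comp tendsto_natCast_atTop_atTop)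
    have h2 : Tendsto (fun n : ℕ => ((y / √n : ℝ) : ℂ)) atTop (𝓝 ((0 : ℝ) : ℂ)) :=
      (Complex.continuous_ofReal.tendsto 0).comp h1
    simpa using h2.const_mul Complex.I
  have hO := (Complex.exp_sub_sum_range_succ_isLittleO_pow 2).comp_tendsto hlim
  have hO2 : (fun n : ℕ => (n : ℂ) * (Complex.exp (Complex.I * ((y / √n : ℝ) : ℂ)) - 1
      - Complex.I * ((y / √n : ℝ) : ℂ)) - (-(y ^ 2 / 2 : ℝ) : ℂ))
      =o[atTop] (fun _ => (1 : ℝ)) := by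
    have hmul := (Asymptotics.isBigO_refl (fun n : ℕ => (n : ℂ)) atTop).mul_isLittleO hO
    refine (hmul.congr' ?_ EventuallyEq.rfl).trans_isBigO ?_
    · filter_upwards [eventually_ge_atTop 1] with n hn
      have hn' : (0 : ℝ) < n := by exact_mod_cast hn
      have hsq : ((y / √n : ℝ) : ℂ) ^ 2 = (y ^ 2 / n : ℝ) := by
        rw [← Complex.ofReal_pow, div_pow, Real.sq_sqrt hn'.le]
      simp only [Function.comp, Finset.sum_range_succ, Finset.sum_range_zero]
      rw [mul_pow _ _ 2, hsq]
      simp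
      have : (n : ℂ) ≠ 0 := by exact_mod_cast hn'.ne'
      field_simp
      ring
    · refine Asymptotics.IsBigO.of_bound (y ^ 2) ?_
      filter_upwards [eventually_ge_atTop 1] with n hn
      have hn' : (0 : ℝ) < n := by exact_mod_cast hn
      simp only [Function.comp, norm_mul, norm_pow, Complex.norm_I, Complex.norm_real, one_mul,
        Complex.norm_natCast, Real.norm_eq_abs, sq_abs, div_pow, Real.sq_sqrt hn'.le]
      rw [mul_div_cancel₀ _ hn'.ne']
      simp
  have := (Asymptotics.isLittleO_one_iff ℝ).1 hO2
  refine (tendsto_sub_nhds_zero_iff).1 this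

variable {p : ℕ → ℝ} {β v : ℝ}

/-- The central limit theorem for characteristic functions. Total mass 1 and centred mean 0 permit
subtracting the Taylor terms 1 and iy inside the series; n times the remainder converges to -vt²/2
by dominated convergence, and (1 + g_n)^n tends to the exponential of lim n·g_n. -/
theorem tendsto_charSeries_pow (hp : ∀ k, 0 ≤ p k) (hsum : HasSum p 1)
    (hmean : HasSum (fun k : ℕ => p k * (k - β)) 0)
    (hvar : HasSum (fun k : ℕ => p k * ((k : ℝ) - β) ^ 2) v) (t : ℝ) :
    Tendsto (fun n : ℕ => (charSeries p (t / √n)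
        * Complex.exp (-(Complex.I * ((β * (t / √n) : ℝ) : ℂ)))) ^ n)
      atTop (𝓝 (Complex.exp (-(v * t ^ 2 / 2 : ℝ)))) := by
  have hexp : ∀ s : ℝ, charSeries p s * Complex.exp (-(Complex.I * ((β * s : ℝ) : ℂ)))
      = 1 + ∑' k : ℕ, (p k : ℂ) * (Complex.exp (Complex.I * ((((k : ℝ) - β) * s : ℝ) : ℂ)) - 1
        - Complex.I * ((((k : ℝ) - β) * s : ℝ) : ℂ)) := by
    intro s
    have hs1 : HasSum (fun k => (p k : ℂ)) 1 := by
      simpa only [Complex.ofReal_one] using Complex.hasSum_ofReal.2 hsum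
    have hs2 : HasSum (fun k : ℕ => ((p k * (k - β) : ℝ) : ℂ)) 0 := by
      simpa only [Complex.ofReal_zero] using Complex.hasSum_ofReal.2 hmean
    have hs3 : Summable fun k => (p k : ℂ) * Complex.exp (Complex.I * s) ^ k := by
      refine Summable.of_norm ?_
      simpa [norm_exp_I_mul_ofReal] using hsum.summable.norm
    have h4 := ((hs3.hasSum.mul_right
      (Complex.exp (-(Complex.I * ((β * s : ℝ) : ℂ))))).sub hs1).sub
        (hs2.mul_right (Complex.I * s))
    rw [zero_mul, sub_zero] at h4
    have h5 := h4.tsum_eq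
    rw [charSeries, ← sub_eq_iff_eq_add', ← h5]
    refine tsum_congr fun k => ?_
    rw [← Complex.exp_nat_mul, mul_assoc, ← Complex.exp_add]
    rw [show (k : ℂ) * (Complex.I * s) + -(Complex.I * ((β * s : ℝ) : ℂ))
      = Complex.I * ((((k : ℝ) - β) * s : ℝ) : ℂ) by push_cast; ring]
    push_cast
    ring
  simp_rw [hexp]
  refine Complex.tendsto_one_add_pow_exp_of_tendsto ?_
  have hlim : (-(v * t ^ 2 / 2 : ℝ) : ℂ)
      = ∑' k : ℕ, (p k : ℂ) * (-(((((k : ℝ) - β) * t) ^ 2 / 2 : ℝ) : ℂ)) := by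
    have := (Complex.hasSum_ofReal.2 (hvar.mul_right (-(t ^ 2 / 2)))).tsum_eq
    rw [show (-(v * t ^ 2 / 2 : ℝ) : ℂ) = ((v * (-(t ^ 2 / 2)) : ℝ) : ℂ) by push_cast; ring]
    refine Eq.trans this.symm (tsum_congr fun k => ?_)
    push_cast; ring
  rw [hlim]
  simp_rw [← tsum_mul_left]
  refine tendsto_tsum_of_dominated_convergence
    (bound := fun k : ℕ => 3 * t ^ 2 * (p k * ((k : ℝ) - β) ^ 2))
    (hvar.summable.mul_left _) (fun k => ?_) (Eventually.of_forall fun n k => ?_)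
  · have := (tendsto_nat_mul_exp_sub (((k : ℝ) - β) * t)).const_mul (p k : ℂ)
    refine this.congr fun n => ?_
    rw [mul_div_assoc]
    ring
  · rw [norm_mul, norm_mul, Complex.norm_natCast, Complex.norm_real, Real.norm_of_nonneg (hp k)]
    rcases Nat.eq_zero_or_pos n with rfl | hn
    · have := hp k
      simp; positivity
    · have hn' : (0 : ℝ) < n := by exact_mod_cast hn
      calc (n : ℝ) * (p k * _)
          ≤ n * (p k * (3 * (((k : ℝ) - β) * (t / √n)) ^ 2)) := by
            gcongr
            · exact hp k
            · exact norm_exp_I_sub_sub_le _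
        _ = 3 * t ^ 2 * (p k * ((k : ℝ) - β) ^ 2) := by
            rw [mul_pow, div_pow, Real.sq_sqrt hn'.le]
            field_simp

/-- A local limit theorem for lattice distributions charging `0` and `1`, at points within bounded
distance of the mean. -/
theorem tendsto_sqrt_mul_coeff_pow (hp : ∀ k, 0 ≤ p k) (hsum : HasSum p 1)
    (h0 : 0 < p 0) (h1 : 0 < p 1)
    (hmean : HasSum (fun k : ℕ => p k * (k - β)) 0)
    (hvar : HasSum (fun k : ℕ => p k * ((k : ℝ) - β) ^ 2) v)
    {K : ℕ → ℕ} (hK : ∀ n : ℕ, 1 ≤ n → |β * n - K n| ≤ 1) :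
    Tendsto (fun n : ℕ => √n * PowerSeries.coeff (K n) (PowerSeries.mk p ^ n)) atTop
      (𝓝 ((2 * Real.pi)⁻¹ * √(Real.pi / (v / 2)))) := by
  have hpi := Real.pi_pos
  set c := 2 * p 0 * p 1 / Real.pi ^ 2 with hc
  have hc0 : 0 < c := by positivity
  -- The inversion integrand after the substitution t = s/√n, extended by zero to the whole line.
  set F : ℕ → ℝ → ℂ := fun n s => (Set.Ioc (-Real.pi * √n) (Real.pi * √n)).indicator
    (fun s : ℝ => charSeries p (s / √n) ^ n
      * Complex.exp (-(K n * Complex.I * ((s / √n : ℝ) : ℂ)))) s with hF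
  have hcont := continuous_charSeries (hsum.summable.norm)
  have hint : Tendsto (fun n => ∫ s, F n s) atTop
      (𝓝 (∫ s : ℝ, Complex.exp (-(v * s ^ 2 / 2 : ℝ)))) := by
    refine tendsto_integral_filter_of_dominated_convergence
      (fun s => Real.exp (-c * s ^ 2)) (Eventually.of_forall fun n => ?_) ?_
      (integrable_exp_neg_mul_sq hc0) (ae_of_all _ fun s => ?_)
    · refine AEStronglyMeasurable.indicator ?_ measurableSet_Ioc
      exact Continuous.aestronglyMeasurable (by fun_prop)
    · filter_upwards [eventually_ge_atTop 1] with n hn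
      refine ae_of_all _ fun s => ?_
      have hn' : (0 : ℝ) < n := by exact_mod_cast hn
      simp only [hF, Set.indicator_apply]
      split_ifs with hs
      · have hsn : |s / √n| ≤ Real.pi := by
          rw [abs_div, abs_of_nonneg (Real.sqrt_nonneg _), div_le_iff₀ (Real.sqrt_pos.2 hn'),
            abs_le]
          exact ⟨by linarith [hs.1], hs.2⟩
        have hb := norm_charSeries_le hp hsum h0 h1 hsn
        have he : ‖Complex.exp (-(K n * Complex.I * ((s / √n : ℝ) : ℂ)))‖ = 1 := by
          rw [show -((K n : ℂ) * Complex.I * ((s / √n : ℝ) : ℂ))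
            = ((-(K n * (s / √n)) : ℝ) : ℂ) * Complex.I by push_cast; ring,
            Complex.norm_exp_ofReal_mul_I]
        rw [norm_mul, he, mul_one, norm_pow]
        calc _ ≤ Real.exp (-(c * (s / √n) ^ 2)) ^ n := by gcongr
          _ = Real.exp (-c * s ^ 2) := by
            rw [← Real.exp_nat_mul, div_pow, Real.sq_sqrt hn'.le]
            congr 1
            field_simp
      · rw [norm_zero]; positivity
    · have hmain := tendsto_charSeries_pow hp hsum hmean hvar s
      -- Centring at K n instead of βn leaves a phase of size at most |s|/√n, which vanishes in the
      -- limit.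
      have hshift : Tendsto (fun n : ℕ =>
          Complex.exp (Complex.I * (((β * n - K n) * (s / √n) : ℝ) : ℂ))) atTop (𝓝 1) := by
        have hz : Tendsto (fun n : ℕ => (β * n - K n) * (s / √n)) atTop (𝓝 0) := by
          have hs0 : Tendsto (fun n : ℕ => s / √(n : ℝ)) atTop (𝓝 0) :=
            tendsto_const_nhds.div_atTop (Real.tendsto_sqrt_atTop.comp tendsto_natCast_atTop_atTop)
          refine squeeze_zero_norm' ?_ (tendsto_norm_zero.comp hs0)
          filter_upwards [eventually_ge_atTop 1] with n hn
          rw [norm_mul]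
          exact mul_le_of_le_one_left (norm_nonneg _) (hK n hn)
        have hc' : Continuous fun x : ℝ => Complex.exp (Complex.I * (x : ℂ)) := by fun_prop
        have := (hc'.tendsto 0).comp hz
        simpa only [Complex.ofReal_zero, mul_zero, Complex.exp_zero, Function.comp_def] using this
      have hprod := hmain.mul hshift
      rw [mul_one] at hprod
      refine hprod.congr' ?_
      have hlarge : ∀ᶠ n : ℕ in atTop, |s| < Real.pi * √(n : ℝ) :=
        ((Real.tendsto_sqrt_atTop.comp tendsto_natCast_atTop_atTop).const_mul_atTop
          hpi).eventually_gt_atTop |s|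
      filter_upwards [hlarge, eventually_ge_atTop 1] with n hn hn1
      have hmem : s ∈ Set.Ioc (-Real.pi * √n) (Real.pi * √n) := by
        obtain ⟨h1, h2⟩ := abs_lt.1 hn
        exact ⟨by linarith, h2.le⟩
      simp only [hF, Set.indicator_of_mem hmem]
      rw [mul_pow, mul_assoc, ← Complex.exp_nat_mul, ← Complex.exp_add]
      congr 2
      push_cast
      ring
  have hgauss : (∫ s : ℝ, Complex.exp (-(v * s ^ 2 / 2 : ℝ)))
      = ((√(Real.pi / (v / 2)) : ℝ) : ℂ) := by
    rw [← integral_gaussian, ← integral_complex_ofReal]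
    refine integral_congr_ae (ae_of_all _ fun s => ?_)
    simp only
    push_cast
    congr 1
    ring
  rw [hgauss] at hint
  have heq : ∀ n : ℕ, 1 ≤ n → ∫ s, F n s = ((2 * Real.pi * (√n *
      PowerSeries.coeff (K n) (PowerSeries.mk p ^ n)) : ℝ) : ℂ) := by
    intro n hn
    have hn' : (0 : ℝ) < n := by exact_mod_cast hn
    have hsq := Real.sqrt_pos.2 hn'
    have hle : -Real.pi * √n ≤ Real.pi * √n := by nlinarith
    simp only [hF]
    rw [integral_indicator measurableSet_Ioc, ← intervalIntegral.integral_of_le hle,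
      intervalIntegral.integral_comp_div (fun t : ℝ => charSeries p t ^ n
      * Complex.exp (-(K n * Complex.I * (t : ℂ)))) hsq.ne', mul_div_cancel_right₀ _ hsq.ne',
      mul_div_cancel_right₀ _ hsq.ne', ← coeff_pow_eq_integral hsum.summable.norm]
    rw [Complex.real_smul]
    push_cast
    ring
  have hre := ((Complex.continuous_re.tendsto _).comp hint).const_mul (2 * Real.pi)⁻¹
  rw [Complex.ofReal_re] at hre
  refine hre.congr' ?_
  filter_upwards [eventually_ge_atTop 1] with n hn
  simp only [Function.comp, heq n hn, Complex.ofReal_re]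
  field_simp

end LocalLimit

/-! ### Truncated Poisson weights; existence and uniqueness of the tuned λ -/

theorem truncWeight_add (d : ℕ) (lam : ℝ) (j : ℕ) :
    truncWeight d lam (j + d) = lam ^ j * ((j + d).factorial : ℝ)⁻¹ := by
  simp [truncWeight, div_eq_mul_inv]

theorem truncWeight_eq_zero {d i : ℕ} (lam : ℝ) (h : i < d) : truncWeight d lam i = 0 :=
  if_pos h

/-- Sums against the truncated Poisson weights only see the values `≥ d`. -/
theorem hasSum_mul_truncWeight_iff (d : ℕ) (lam : ℝ) (f : ℕ → ℝ) (s : ℝ) :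
    HasSum (fun i => f i * truncWeight d lam i) s ↔
      HasSum (fun j => f (j + d) * (lam ^ j * ((j + d).factorial : ℝ)⁻¹)) s := by
  rw [← hasSum_nat_add_iff' d]
  have : ∑ i ∈ Finset.range d, f i * truncWeight d lam i = 0 :=
    Finset.sum_eq_zero fun i hi => by
      rw [truncWeight_eq_zero lam (Finset.mem_range.1 hi), mul_zero]
  rw [this, sub_zero]
  simp only [truncWeight_add]

theorem summable_sq_mul_weights (d : ℕ) (lam : ℝ) :
    Summable fun j : ℕ => (j : ℝ) ^ 2 * ‖lam ^ j * ((j + d).factorial : ℝ)⁻¹‖ := by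
  refine Summable.of_nonneg_of_le (fun j => by positivity) (fun j => ?_)
    ((Real.summable_pow_div_factorial (4 * |lam|)))
  rw [norm_mul, norm_pow, Real.norm_eq_abs, norm_inv, Real.norm_natCast, mul_pow, div_eq_mul_inv]
  have h₁ : (j : ℝ) ^ 2 ≤ 4 ^ j := by
    have : (j : ℝ) ≤ 2 ^ j := by exact_mod_cast (Nat.lt_two_pow_self).le
    calc (j : ℝ) ^ 2 ≤ (2 ^ j) ^ 2 := by gcongr
      _ = 4 ^ j := by rw [← pow_mul, mul_comm, pow_mul]; norm_num
  have h₂ : ((j + d).factorial : ℝ)⁻¹ ≤ (j.factorial : ℝ)⁻¹ := by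
    gcongr
    omega
  rw [mul_assoc]
  gcongr

theorem summable_weights (d : ℕ) (lam : ℝ) :
    Summable fun j : ℕ => ‖lam ^ j * ((j + d).factorial : ℝ)⁻¹‖ := by
  refine Summable.of_nonneg_of_le (fun j => by positivity) (fun j => ?_)
    ((Real.summable_pow_div_factorial |lam|))
  rw [norm_mul, norm_pow, Real.norm_eq_abs, norm_inv, Real.norm_natCast, div_eq_mul_inv]
  gcongr
  omega

theorem hasSum_zeta (d : ℕ) (lam : ℝ) :
    HasSum (fun j : ℕ => lam ^ j * ((j + d).factorial : ℝ)⁻¹) (zeta d lam) := by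
  have h := (hasSum_mul_truncWeight_iff d lam (fun _ => 1)
    (∑' j : ℕ, lam ^ j * ((j + d).factorial : ℝ)⁻¹)).2
      (by simpa using (summable_weights d lam).of_norm.hasSum)
  have h' : zeta d lam = ∑' j : ℕ, lam ^ j * ((j + d).factorial : ℝ)⁻¹ := by
    simpa [zeta] using h.tsum_eq
  rw [h']
  exact (summable_weights d lam).of_norm.hasSum

theorem zeta_pos (d : ℕ) {lam : ℝ} (h : 0 ≤ lam) : 0 < zeta d lam := by
  have := (hasSum_zeta d lam)
  refine lt_of_lt_of_le ?_ (le_hasSum this 0 fun j _ => by positivity)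
  simp; positivity

/-- Multiplying by ζ removes the normalisation and leaves a centred series, linear in the weights.
-/
theorem isTuned_iff (α : ℝ) (d : ℕ) (lam : ℝ) :
    IsTuned α d lam ↔ 0 < lam ∧
      HasSum (fun j : ℕ => ((j : ℝ) + d - α) * (lam ^ j * ((j + d).factorial : ℝ)⁻¹)) 0 := by
  refine and_congr_right fun hlam => ?_
  have hz := (zeta_pos d hlam.le).ne'
  have h₁ : HasSum (fun i : ℕ => (i : ℝ) * truncPoisson d lam i) α ↔
      HasSum (fun i : ℕ => (i : ℝ) * truncWeight d lam i) (α * zeta d lam) := by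
    rw [← hasSum_mul_right_iff hz]
    simp only [truncPoisson]
    refine iff_of_eq (congrArg (fun f => HasSum f (α * zeta d lam)) ?_)
    ext i; field_simp
  rw [h₁, hasSum_mul_truncWeight_iff]
  have hζ := (hasSum_zeta d lam).mul_left α
  constructor
  · intro h
    convert! h.sub hζ using 1
    · ext j; push_cast; ring
    · ring
  · intro h
    convert! h.add hζ using 1
    · ext j; push_cast; ring
    · ring

/-- The factor j + d - α changes sign once, at K = ⌈α - d⌉. Passing from x to y > x multiplies term
j by (y/x)^j; replacing this by (y/x)^K lowers every term, strictly at j = 0. So the series at y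
would exceed (y/x)^K · 0 = 0. -/
theorem IsTuned.unique {α : ℝ} {d : ℕ} (hα : (d : ℝ) < α) {x y : ℝ}
    (hx : IsTuned α d x) (hy : IsTuned α d y) : x = y := by
  wlog hxy : x < y generalizing x y
  · rcases lt_trichotomy x y with h | h | h
    · exact this hx hy h
    · exact h
    · exact (this hy hx h).symm
  exfalso
  rw [isTuned_iff] at hx hy
  obtain ⟨hx0, hx⟩ := hx
  obtain ⟨hy0, hy⟩ := hy
  set K := ⌈α - d⌉₊ with hK
  have hKpos : 0 < K := Nat.ceil_pos.2 (by linarith)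
  have h₁ := hx.mul_left ((y / x) ^ K)
  rw [mul_zero] at h₁
  have hr : 1 < y / x := (one_lt_div hx0).2 hxy
  have key : ∀ j : ℕ, (y / x) ^ K * (((j : ℝ) + d - α) * (x ^ j * ((j + d).factorial : ℝ)⁻¹))
      = (y / x) ^ K * ((j : ℝ) + d - α) * (x ^ j * ((j + d).factorial : ℝ)⁻¹) := fun j => by ring
  have key' : ∀ j : ℕ, (((j : ℝ) + d - α) * (y ^ j * ((j + d).factorial : ℝ)⁻¹))
      = (y / x) ^ j * ((j : ℝ) + d - α) * (x ^ j * ((j + d).factorial : ℝ)⁻¹) := fun j => by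
    rw [div_pow]; field_simp
  refine lt_irrefl (0 : ℝ) (hasSum_lt (i := 0) (fun j => ?_) ?_ h₁ hy)
  · rw [key, key']
    refine mul_le_mul_of_nonneg_right ?_ (by positivity)
    rcases lt_or_ge j K with hj | hj
    · have : (j : ℝ) < α - d := Nat.lt_ceil.1 hj
      exact mul_le_mul_of_nonpos_right (pow_le_pow_right₀ hr.le hj.le) (by linarith)
    · have : α - d ≤ (j : ℝ) := Nat.ceil_le.1 hj
      exact mul_le_mul_of_nonneg_right (pow_le_pow_right₀ hr.le hj) (by linarith)
  · rw [key, key']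
    refine mul_lt_mul_of_pos_right ?_ (by positivity)
    refine mul_lt_mul_of_neg_right (pow_lt_pow_right₀ hr hKpos) ?_
    push_cast; linarith

theorem continuous_zeta (d : ℕ) : Continuous (zeta d) := by
  have hfun : zeta d = fun lam => ∑' j : ℕ, lam ^ j * ((j + d).factorial : ℝ)⁻¹ := by
    ext lam; exact (hasSum_zeta d lam).tsum_eq.symm
  rw [continuous_iff_continuousAt]
  intro x
  have hon : ContinuousOn (zeta d) (Metric.ball 0 (|x| + 1)) := by
    rw [hfun]
    refine continuousOn_tsum (fun j => by fun_prop) (summable_weights d (|x| + 1)) ?_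
    intro j y hy
    rw [norm_mul, norm_mul, norm_pow, norm_pow]
    gcongr
    rw [mem_ball_zero_iff] at hy
    rw [Real.norm_of_nonneg (by positivity : 0 ≤ |x| + 1)]
    exact hy.le
  exact hon.continuousAt (Metric.isOpen_ball.mem_nhds (by simp))

/-- The mean of the truncated Poisson weights, by an index shift. -/
theorem hasSum_mean_weights (d : ℕ) (lam : ℝ) :
    HasSum (fun j : ℕ => ((j : ℝ) + d) * (lam ^ j * ((j + d).factorial : ℝ)⁻¹))
      (lam * zeta d lam + d * (d.factorial : ℝ)⁻¹) := by
  rw [← hasSum_nat_add_iff' 1]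
  have h := (hasSum_zeta d lam).mul_left lam
  convert! h using 1
  · ext j
    have : (j + 1 + d).factorial = (j + d + 1) * (j + d).factorial := by
      rw [← Nat.factorial_succ]; congr 1; ring
    rw [this]
    push_cast
    field_simp
    ring
  · simp

/-- By the mean identity, tuning means (x - α)ζ(x) + d/d! = 0. The left side is (d - α)/d! < 0 at x
= 0 and d/d! ≥ 0 at x = α. -/
theorem exists_isTuned {α : ℝ} {d : ℕ} (hα : (d : ℝ) < α) : ∃ lam, IsTuned α d lam := by
  have hα0 : 0 ≤ α := (Nat.cast_nonneg d).trans hα.le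
  have hcont : Continuous fun x : ℝ => (x - α) * zeta d x + d * (d.factorial : ℝ)⁻¹ := by
    have := continuous_zeta d
    fun_prop
  have hzero : zeta d 0 = (d.factorial : ℝ)⁻¹ := by
    rw [← (hasSum_zeta d 0).tsum_eq, tsum_eq_single 0 (fun j hj => by simp [hj])]
    simp
  have hneg : (0 - α) * zeta d 0 + d * (d.factorial : ℝ)⁻¹ < 0 := by
    rw [hzero]
    have : (0 : ℝ) < (d.factorial : ℝ)⁻¹ := by positivity
    nlinarith
  obtain ⟨x, hx, hx0⟩ := intermediate_value_Icc hα0 hcont.continuousOn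
    (show (0 : ℝ) ∈ Set.Icc _ _ from ⟨hneg.le, by simp; positivity⟩)
  refine ⟨x, (isTuned_iff α d x).2 ⟨lt_of_le_of_ne hx.1 ?_, ?_⟩⟩
  · rintro rfl
    exact hneg.ne hx0
  · convert! (hasSum_mean_weights d x).sub ((hasSum_zeta d x).mul_left α) using 1
    · ext j; ring
    · simp only at hx0
      linarith

theorem existsUnique_isTuned {α : ℝ} {d : ℕ} (hα : (d : ℝ) < α) : ∃! lam, IsTuned α d lam := by
  obtain ⟨x, hx⟩ := exists_isTuned hα
  exact ⟨x, hx, fun y hy => hy.unique hα hx⟩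

/-! ### The numerical example α = 2, d = 1 -/

theorem zeta_one_eq {lam : ℝ} (h : lam ≠ 0) : zeta 1 lam = (Real.exp lam - 1) / lam := by
  have h₁ : HasSum (fun j : ℕ => lam ^ j / (j.factorial : ℝ)) (Real.exp lam) := by
    rw [Real.exp_eq_exp_ℝ]
    exact NormedSpace.expSeries_div_hasSum_exp lam
  rw [← hasSum_nat_add_iff' 1] at h₁
  have h₂ := (hasSum_zeta 1 lam).mul_left lam
  rw [eq_div_iff h, mul_comm]
  refine h₂.unique ?_
  convert! h₁ using 1
  · ext j; rw [pow_succ]; ring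
  · simp

theorem IsTuned.exp_mul_eq {lam : ℝ} (h : IsTuned 2 1 lam) :
    Real.exp lam * (2 - lam) = 2 := by
  obtain ⟨hlam, h⟩ := (isTuned_iff 2 1 lam).1 h
  have h' := (hasSum_mean_weights 1 lam).sub ((hasSum_zeta 1 lam).mul_left 2)
  have heq := h.unique (by convert! h' using 1; ext j; ring)
  rw [zeta_one_eq hlam.ne'] at heq
  simp at heq
  field_simp at heq
  linarith

/-- Convexity puts e^(-x) below the chord over [0, y]; equivalently, (1 - e^(-t))/t is
nonincreasing. The tuned λ is where this ratio equals 1/2, so the sign of 2e^(-y) - (2 - y) tells on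
which side of y it lies. -/
theorem exp_scale_le {x y : ℝ} (hx : 0 ≤ x) (hxy : x ≤ y) (hy : 0 < y) :
    y * Real.exp (-x) ≤ x * Real.exp (-y) + (y - x) := by
  have h := convexOn_exp.2 (Set.mem_univ (-y)) (Set.mem_univ 0) (div_nonneg hx hy.le)
    (sub_nonneg.2 ((div_le_one hy).2 hxy)) (by ring)
  simp only [smul_eq_mul, mul_zero, add_zero, Real.exp_zero, mul_one] at h
  rw [show x / y * -y = -x by field_simp] at h
  calc y * Real.exp (-x) ≤ y * (x / y * Real.exp (-y) + (1 - x / y)) := by gcongr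
    _ = x * Real.exp (-y) + (y - x) := by field_simp

theorem exp_lower_bound : 2 / (2 - 1.5935) < Real.exp 1.5935 := by
  have h : Real.exp 1.5935 = Real.exp 1 * Real.exp 0.5935 := by
    rw [← Real.exp_add]; norm_num
  have h₁ := Real.exp_one_gt_d9
  have h₂ := Real.sum_le_exp_of_nonneg (x := 0.5935) (by norm_num) 7
  rw [h]
  refine lt_of_lt_of_le ?_ (mul_le_mul h₁.le h₂ (by positivity) (by positivity))
  norm_num [Finset.sum_range_succ, Nat.factorial]

theorem exp_upper_bound : Real.exp 1.594 < 2 / (2 - 1.594) := by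
  have h : Real.exp 1.594 = Real.exp 1 * Real.exp 0.594 := by
    rw [← Real.exp_add]; norm_num
  have h₁ := Real.exp_one_lt_d9
  have h₂ := Real.exp_bound' (x := 0.594) (by norm_num) (by norm_num) (n := 7) (by norm_num)
  rw [h]
  refine lt_of_le_of_lt (mul_le_mul h₁.le h₂ (by positivity) (by positivity)) ?_
  norm_num [Finset.sum_range_succ, Nat.factorial]

theorem IsTuned.mem_Icc {lam : ℝ} (h : IsTuned 2 1 lam) :
    1.5935 ≤ lam ∧ lam ≤ 1.594 := by
  have hlam := h.1
  have heq := h.exp_mul_eq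
  have hinv : 2 * Real.exp (-lam) = 2 - lam := by
    have : Real.exp lam * Real.exp (-lam) = 1 := by rw [← Real.exp_add]; simp
    linear_combination (-Real.exp (-lam)) * heq + (2 - lam) * this
  constructor
  · by_contra! hlt
    have h₁ := exp_scale_le hlam.le hlt.le (by norm_num)
    have h₂ : 2 * Real.exp (-1.5935) < 2 - 1.5935 := by
      rw [Real.exp_neg]
      have := exp_lower_bound
      rw [div_lt_iff₀ (by norm_num)] at this
      rw [← div_eq_mul_inv, div_lt_iff₀ (by positivity)]
      linarith
    nlinarith
  · by_contra! hlt
    have h₁ := exp_scale_le (x := 1.594) (by norm_num) hlt.le hlam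
    have h₂ : 2 - 1.594 < 2 * Real.exp (-1.594) := by
      rw [Real.exp_neg]
      have := exp_upper_bound
      rw [lt_div_iff₀ (by norm_num)] at this
      rw [← div_eq_mul_inv, lt_div_iff₀ (by positivity)]
      linarith
    nlinarith

theorem base_two_one {lam : ℝ} (h : IsTuned 2 1 lam) :
    |base 2 1 lam - 0.836| < 0.0005 := by
  obtain ⟨hl, hu⟩ := h.mem_Icc
  have heq := h.exp_mul_eq
  have hlam := h.1
  have h2 : (0 : ℝ) < 2 - lam := by linarith
  have hζ : zeta 1 lam = 1 / (2 - lam) := by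
    rw [zeta_one_eq hlam.ne', div_eq_div_iff hlam.ne' h2.ne']
    linarith
  have hbase : base 2 1 lam = 4 / (Real.exp 2 * (lam * (2 - lam))) := by
    rw [base, hζ]
    norm_num
    field_simp
  have he : Real.exp 2 = Real.exp 1 ^ 2 := by rw [← Real.exp_nat_mul]; norm_num
  have he₁ := Real.exp_one_gt_d9
  have he₂ := Real.exp_one_lt_d9
  have hlo : (7.389 : ℝ) < Real.exp 2 := by rw [he]; nlinarith
  have hhi : Real.exp 2 < 7.3892 := by rw [he]; nlinarith
  -- The function λ(2 - λ) decreases for λ > 1; both bounds are its endpoint values rounded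
  -- outwards.
  have hp : 0.64716 ≤ lam * (2 - lam) := by nlinarith
  have hq : lam * (2 - lam) ≤ 0.64776 := by nlinarith
  rw [hbase, abs_lt]
  have hpos : 0 < Real.exp 2 * (lam * (2 - lam)) := by positivity
  constructor
  · rw [lt_sub_iff_add_lt, lt_div_iff₀ hpos]
    nlinarith
  · rw [sub_lt_iff_lt_add, div_lt_iff₀ hpos]
    nlinarith

/-! ### Constants valid for all n, Stirling's formula, and the case of dn balls -/

theorem exists_pos_lower_bound {r : ℕ → ℝ} (hr : ∀ n, 1 ≤ n → 0 < r n) {c : ℝ} (hc : 0 < c)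
    (h : ∀ᶠ n in atTop, c ≤ r n) : ∃ c' : ℝ, 0 < c' ∧ ∀ n, 1 ≤ n → c' ≤ r n := by
  obtain ⟨N, hN⟩ := eventually_atTop.1 h
  have hfin : ∀ M : ℕ, ∃ c' : ℝ, 0 < c' ∧ ∀ n, 1 ≤ n → n < M → c' ≤ r n := by
    intro M
    induction M with
    | zero => exact ⟨1, one_pos, fun n _ hn => absurd hn (by omega)⟩
    | succ M ih =>
      obtain ⟨c', hc', h'⟩ := ih
      rcases Nat.eq_zero_or_pos M with rfl | hM
      · exact ⟨1, one_pos, fun n _ _ => by omega⟩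
      · refine ⟨min c' (r M), lt_min hc' (hr M hM), fun n hn hnM => ?_⟩
        rcases Nat.lt_succ_iff_lt_or_eq.1 hnM with hlt | rfl
        · exact (min_le_left _ _).trans (h' n hn hlt)
        · exact min_le_right _ _
  obtain ⟨c', hc', h'⟩ := hfin N
  refine ⟨min c c', lt_min hc hc', fun n hn => ?_⟩
  rcases lt_or_ge n N with hlt | hge
  · exact (min_le_right _ _).trans (h' n hn hlt)
  · exact (min_le_left _ _).trans (hN n hge)

/-- Finitely many positive values are absorbed into the constants; the upper bound is the lower
bound for 1/r. -/
theorem exists_pos_bounds {r : ℕ → ℝ} (hr : ∀ n, 1 ≤ n → 0 < r n) {c C : ℝ} (hc : 0 < c)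
    (hC : 0 < C) (h : ∀ᶠ n in atTop, c ≤ r n ∧ r n ≤ C) :
    ∃ c' C' : ℝ, 0 < c' ∧ 0 < C' ∧ ∀ n, 1 ≤ n → c' ≤ r n ∧ r n ≤ C' := by
  obtain ⟨c', hc', h₁⟩ := exists_pos_lower_bound hr hc (h.mono fun n hn => hn.1)
  obtain ⟨C', hC', h₂⟩ := exists_pos_lower_bound (r := fun n => (r n)⁻¹)
    (fun n hn => inv_pos.2 (hr n hn)) (inv_pos.2 hC)
    (by
      filter_upwards [h, eventually_ge_atTop 1] with n hn hn1
      exact inv_anti₀ (hr n hn1) hn.2)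
  exact ⟨c', C'⁻¹, hc', inv_pos.2 hC', fun n hn =>
    ⟨h₁ n hn, (le_inv_comm₀ (hr n hn) hC').2 (h₂ n hn)⟩⟩

theorem factorial_eq_stirlingSeq_mul {m : ℕ} (hm : 1 ≤ m) :
    (m.factorial : ℝ) = Stirling.stirlingSeq m * (√2 * √m * (m / Real.exp 1) ^ m) := by
  have hm' : (0 : ℝ) < m := by exact_mod_cast hm
  rw [Stirling.stirlingSeq, ← Real.sqrt_mul (by norm_num)]
  field_simp

theorem stirlingSeq_le {m : ℕ} (hm : 1 ≤ m) : Stirling.stirlingSeq m ≤ Real.exp 1 / √2 := by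
  obtain ⟨k, rfl⟩ := Nat.exists_eq_add_of_le' hm
  rw [← Stirling.stirlingSeq_one]
  exact Stirling.stirlingSeq'_antitone (Nat.zero_le k)

theorem probAllLoaded_exact_eq_stirlingSeq_mul {d n : ℕ} (hd : 1 ≤ d) (hn : 1 ≤ n) :
    probAllLoaded (d * n) n d = √2 * Stirling.stirlingSeq (d * n)
      * (baseExact d ^ n * √((d : ℝ) * (n : ℝ))) := by
  have hn' : (0 : ℝ) < n := by exact_mod_cast hn
  have hb : baseExact d ^ n
      = (d : ℝ) ^ (d * n) / (Real.exp 1 ^ (d * n) * (d.factorial : ℝ) ^ n) := by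
    rw [baseExact, div_pow, mul_pow, ← pow_mul, pow_mul (Real.exp 1),
      ← Real.exp_nat_mul 1 d, mul_one]
  rw [probAllLoaded_exact, factorial_eq_stirlingSeq_mul (Nat.mul_pos hd hn), hb, div_pow]
  push_cast
  rw [mul_pow]
  field_simp

/-- The quotient is exactly √2 times the Stirling sequence at dn, which decreases from e/√2 and
stays above √π; hence the constants do not depend on d. -/
theorem exact_bounds : ∃ c C : ℝ, 0 < c ∧ 0 < C ∧ ∀ d n : ℕ, 1 ≤ d → 1 ≤ n →
      c * (baseExact d ^ n * √((d : ℝ) * (n : ℝ))) ≤ probAllLoaded (d * n) n d ∧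
      probAllLoaded (d * n) n d ≤ C * (baseExact d ^ n * √((d : ℝ) * (n : ℝ))) := by
  refine ⟨√2 * √Real.pi, √2 * (Real.exp 1 / √2), by positivity, by positivity, ?_⟩
  intro d n hd hn
  have hdn : 1 ≤ d * n := Nat.mul_pos hd hn
  have hb : 0 ≤ baseExact d := by rw [baseExact]; positivity
  rw [probAllLoaded_exact_eq_stirlingSeq_mul hd hn]
  constructor
  · gcongr
    exact Stirling.sqrt_pi_le_stirlingSeq (by omega)
  · gcongr
    exact stirlingSeq_le hdn

/-! ### Exponential tilting and the tuned case -/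

/-- The truncated Poisson mass function, shifted to start at `0`. -/
noncomputable def shiftedMass (d : ℕ) (lam : ℝ) (j : ℕ) : ℝ :=
  lam ^ j * ((j + d).factorial : ℝ)⁻¹ / zeta d lam

theorem coeff_loadSeries_pow (d n k : ℕ) {lam : ℝ} (hlam : 0 < lam) :
    PowerSeries.coeff k (loadSeries d ^ n)
      = zeta d lam ^ n / lam ^ k * PowerSeries.coeff k (PowerSeries.mk (shiftedMass d lam) ^ n) := by
  have hz := zeta_pos d hlam.le
  have h : PowerSeries.mk (shiftedMass d lam)
      = PowerSeries.C (zeta d lam)⁻¹ * PowerSeries.rescale lam (loadSeries d) := by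
    ext j
    simp [shiftedMass, loadSeries, PowerSeries.coeff_rescale]
    ring
  rw [h, mul_pow, ← map_pow, ← map_pow, PowerSeries.coeff_C_mul, PowerSeries.coeff_rescale, inv_pow]
  field_simp

theorem IsTuned.exists_tendsto_sqrt_mul_coeff {α lam : ℝ} {d : ℕ} (h : IsTuned α d lam)
    {K : ℕ → ℕ} (hK : ∀ n : ℕ, 1 ≤ n → |(α - d) * n - K n| ≤ 1) :
    ∃ L : ℝ, 0 < L ∧ Tendsto
      (fun n : ℕ => √n * PowerSeries.coeff (K n) (PowerSeries.mk (shiftedMass d lam) ^ n))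
      atTop (𝓝 L) := by
  obtain ⟨hlam, hmean⟩ := (isTuned_iff α d lam).1 h
  have hz := zeta_pos d hlam.le
  have hpos : ∀ k, 0 < shiftedMass d lam k := fun k => by rw [shiftedMass]; positivity
  have hsum : HasSum (shiftedMass d lam) 1 := by
    have := (hasSum_zeta d lam).div_const (zeta d lam)
    rwa [div_self hz.ne'] at this
  have hmean' : HasSum (fun k : ℕ => shiftedMass d lam k * ((k : ℝ) - (α - d))) 0 := by
    have := hmean.div_const (zeta d lam)
    rw [zero_div] at this
    refine this.congr_fun fun k => ?_
    rw [shiftedMass]; ring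
  have hs2 : Summable fun k : ℕ => shiftedMass d lam k * (k : ℝ) ^ 2 := by
    refine ((summable_sq_mul_weights d lam).div_const (zeta d lam)).congr fun k => ?_
    rw [Real.norm_of_nonneg (by positivity), shiftedMass]; ring
  have hvar : Summable fun k : ℕ => shiftedMass d lam k * ((k : ℝ) - (α - d)) ^ 2 := by
    refine ((hs2.add (hmean'.summable.mul_left (-2 * (α - d)))).sub
      (hsum.summable.mul_left ((α - d) ^ 2))).congr fun k => ?_
    ring
  have hv : 0 < ∑' k : ℕ, shiftedMass d lam k * ((k : ℝ) - (α - d)) ^ 2 := by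
    have hnn : ∀ k : ℕ, 0 ≤ shiftedMass d lam k * ((k : ℝ) - (α - d)) ^ 2 := fun k =>
      mul_nonneg (hpos k).le (sq_nonneg _)
    -- Positive variance needs one charged point other than the mean: 1 if the mean is 0, otherwise
    -- 0.
    by_cases hβ : α - d = 0
    · refine hvar.tsum_pos hnn 1 (mul_pos (hpos 1) ?_)
      rw [hβ]; norm_num
    · refine hvar.tsum_pos hnn 0 (mul_pos (hpos 0) ?_)
      push_cast
      rw [zero_sub, neg_sq]
      positivity
  exact ⟨_, by positivity, tendsto_sqrt_mul_coeff_pow (fun k => (hpos k).le) hsum (hpos 0) (hpos 1)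
    hmean' hvar.hasSum hK⟩

/-- Bounds the cost of replacing αn = m + θ by its integer part m in the m-th power, through (1 +
θ/m)^m ≤ e^θ. -/
theorem le_div_add_pow {m : ℕ} {θ : ℝ} (hm : 1 ≤ m) (hθ : 0 ≤ θ) (hθ1 : θ ≤ 1) :
    (Real.exp 1)⁻¹ ≤ (m / (m + θ)) ^ m := by
  have hm' : (0 : ℝ) < m := by exact_mod_cast hm
  rw [inv_le_comm₀ (by positivity) (by positivity), ← inv_pow, inv_div]
  calc ((m + θ) / m) ^ m = (θ / m + 1) ^ m := by rw [add_div, div_self hm'.ne', add_comm]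
    _ ≤ Real.exp (θ / m) ^ m := by
      gcongr
      exact Real.add_one_le_exp _
    _ = Real.exp θ := by rw [← Real.exp_nat_mul]; congr 1; field_simp
    _ ≤ Real.exp 1 := Real.exp_le_exp.2 hθ1

theorem rpow_bounds_of_mem_Icc {x θ : ℝ} (hx : 0 < x) (hθ : 0 ≤ θ) (hθ1 : θ ≤ 1) :
    min 1 x ≤ x ^ θ ∧ x ^ θ ≤ max 1 x := by
  rcases le_total 1 x with h | h
  · exact ⟨(min_le_left _ _).trans (Real.one_le_rpow h hθ),
      (Real.rpow_le_self_of_one_le h hθ1).trans (le_max_right _ _)⟩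
  · exact ⟨(min_le_right _ _).trans (Real.self_le_rpow_of_le_one hx.le h hθ1),
      (Real.rpow_le_one hx.le h hθ).trans (le_max_left _ _)⟩

theorem base_pow_eq {α lam θ : ℝ} {d n m k : ℕ} (hα : 0 < α) (hlam : 0 < lam)
    (hm : α * n = m + θ) (hk : m = k + d * n) :
    base α d lam ^ n = α ^ m * zeta d lam ^ n / (Real.exp 1 ^ m * lam ^ k)
      * (α / (Real.exp 1 * lam)) ^ θ := by
  have h₁ : (α ^ α) ^ n = α ^ m * α ^ θ := by
    rw [← Real.rpow_mul_natCast hα.le, hm, Real.rpow_add hα, Real.rpow_natCast]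
  have h₂ : Real.exp α ^ n = Real.exp 1 ^ m * Real.exp 1 ^ θ := by
    rw [← Real.exp_nat_mul, ← Real.exp_nat_mul, ← Real.exp_mul, ← Real.exp_add]
    congr 1
    linarith
  have h₃ : (lam ^ (α - d)) ^ n = lam ^ k * lam ^ θ := by
    rw [← Real.rpow_mul_natCast hlam.le, ← Real.rpow_natCast lam k, ← Real.rpow_add hlam]
    congr 1
    have : (m : ℝ) = k + d * n := by exact_mod_cast hk
    linarith
  rw [base, div_pow, mul_pow, mul_pow, h₁, h₂, h₃, Real.div_rpow hα.le (by positivity),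
    Real.mul_rpow (Real.exp_pos 1).le hlam.le]
  field_simp

/-- An exact factorisation in which every factor before b^n is bounded above and away from zero for
large n; θ is the rounding error αn - m. -/
theorem probAllLoaded_eq_base_pow_mul {α lam θ : ℝ} {d n m k : ℕ} (hα : 0 < α) (hlam : 0 < lam)
    (hn : 1 ≤ n) (hm1 : 1 ≤ m) (hm : α * n = m + θ) (hk : m = k + d * n) :
    probAllLoaded m n d = Stirling.stirlingSeq m * √2 * √(m / n)
      * (√n * PowerSeries.coeff k (PowerSeries.mk (shiftedMass d lam) ^ n))
      * (m / (m + θ)) ^ m * (Real.exp 1 * lam / α) ^ θ * base α d lam ^ n := by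
  have hn' : (0 : ℝ) < n := by exact_mod_cast hn
  have hm' : (0 : ℝ) < m := by exact_mod_cast hm1
  have hz := zeta_pos d hlam.le
  have hkk : m - d * n = k := by omega
  rw [probAllLoaded_eq (by omega), hkk, coeff_loadSeries_pow d n k hlam,
    factorial_eq_stirlingSeq_mul hm1, base_pow_eq hα hlam hm hk, ← hm,
    ← inv_div (Real.exp 1 * lam) α, Real.inv_rpow (by positivity), Real.sqrt_div hm'.le,
    div_pow, div_pow, mul_pow]
  have : 0 < (Real.exp 1 * lam / α) ^ θ := by positivity
  have hsn : 0 < √(n : ℝ) := Real.sqrt_pos.2 hn'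
  field_simp

theorem tuned_bounds {α lam : ℝ} {d : ℕ} (hα : (d : ℝ) < α) (h : IsTuned α d lam) :
    ∃ c C : ℝ, 0 < c ∧ 0 < C ∧ ∀ n : ℕ, 1 ≤ n →
      c * base α d lam ^ n ≤ probAllLoaded ⌊α * (n : ℝ)⌋₊ n d ∧
      probAllLoaded ⌊α * (n : ℝ)⌋₊ n d ≤ C * base α d lam ^ n := by
  have hlam := h.1
  have hα0 : 0 < α := (Nat.cast_nonneg d).trans_lt hα
  have hz := zeta_pos d hlam.le
  have hb : 0 < base α d lam := by rw [base]; positivity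
  have hfl : ∀ n : ℕ, d * n ≤ ⌊α * (n : ℝ)⌋₊ := fun n => by
    rw [Nat.le_floor_iff (by positivity)]
    push_cast
    gcongr
  have hK : ∀ n : ℕ, 1 ≤ n →
      |(α - d) * n - ((⌊α * (n : ℝ)⌋₊ - d * n : ℕ) : ℝ)| ≤ 1 := by
    intro n _
    rw [Nat.cast_sub (hfl n)]
    push_cast
    have h₁ := Nat.floor_le (show 0 ≤ α * (n : ℝ) by positivity)
    have h₂ := Nat.lt_floor_add_one (α * (n : ℝ))
    rw [abs_le]
    constructor <;> linarith
  obtain ⟨L, hL, hlim⟩ := h.exists_tendsto_sqrt_mul_coeff hK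
  set x := Real.exp 1 * lam / α with hx
  have hx0 : 0 < x := by positivity
  have hev : ∀ᶠ n : ℕ in atTop,
      -- The two constants multiply the bounds for the individual factors of
      -- `probAllLoaded_eq_base_pow_mul`.
      √Real.pi * √2 * √(α / 2) * (L / 2) * (Real.exp 1)⁻¹ * min 1 x
          ≤ probAllLoaded ⌊α * (n : ℝ)⌋₊ n d / base α d lam ^ n ∧
      probAllLoaded ⌊α * (n : ℝ)⌋₊ n d / base α d lam ^ n
          ≤ Real.exp 1 / √2 * √2 * √α * (2 * L) * 1 * max 1 x := by
    -- This gives m ≥ 1 and m ≥ αn - 1 ≥ αn/2, whence the factor √(α/2).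
    have hlarge : ∀ᶠ n : ℕ in atTop, 2 ≤ α * (n : ℝ) :=
      (tendsto_natCast_atTop_atTop.const_mul_atTop hα0).eventually_ge_atTop 2
    filter_upwards [hlim.eventually_const_le (half_lt_self hL),
      hlim.eventually_le_const (show L < 2 * L by linarith), hlarge,
      eventually_ge_atTop 1] with n hlo hhi h2 hn
    have hn' : (0 : ℝ) < n := by exact_mod_cast hn
    set m := ⌊α * (n : ℝ)⌋₊ with hm
    have h₁ := Nat.floor_le (show 0 ≤ α * (n : ℝ) by positivity)
    have h₂ := Nat.lt_floor_add_one (α * (n : ℝ))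
    rw [← hm] at h₁ h₂
    set θ := α * n - m with hθ
    have hθ0 : 0 ≤ θ := by linarith
    have hθ1 : θ ≤ 1 := by linarith
    have hm1 : 1 ≤ m := by
      rw [hm, Nat.one_le_floor_iff]; linarith
    have hm' : (0 : ℝ) < m := by exact_mod_cast hm1
    rw [probAllLoaded_eq_base_pow_mul (θ := θ) (k := m - d * n) hα0 hlam hn hm1 (by linarith)
      (Nat.sub_add_cancel (hfl n)).symm, mul_div_cancel_right₀ _ (pow_pos hb n).ne', ← hx]
    obtain ⟨hr₁, hr₂⟩ := rpow_bounds_of_mem_Icc hx0 hθ0 hθ1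
    have hs₁ := Stirling.sqrt_pi_le_stirlingSeq (n := m) (by omega)
    have hs₂ := stirlingSeq_le hm1
    have hp₁ := le_div_add_pow hm1 hθ0 hθ1
    have hp₂ : ((m : ℝ) / (m + θ)) ^ m ≤ 1 :=
      pow_le_one₀ (by positivity) ((div_le_one (by positivity)).2 (by linarith))
    have hq₁ : √(α / 2) ≤ √((m : ℝ) / n) := by
      apply Real.sqrt_le_sqrt
      rw [le_div_iff₀ hn']
      linarith
    have hq₂ : √((m : ℝ) / n) ≤ √α := by
      apply Real.sqrt_le_sqrt
      rw [div_le_iff₀ hn']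
      exact h₁
    have hs₀ : 0 ≤ Stirling.stirlingSeq m := (Real.sqrt_nonneg _).trans hs₁
    have hl₀ : 0 ≤ √(n : ℝ) * PowerSeries.coeff (m - d * n)
        (PowerSeries.mk (shiftedMass d lam) ^ n) := by linarith
    constructor
    · gcongr
    · gcongr
  obtain ⟨c, C, hc, hC, hcC⟩ := exists_pos_bounds
    (fun n hn => div_pos (probAllLoaded_pos hn (hfl n)) (pow_pos hb n))
    (by positivity) (by positivity) hev
  refine ⟨c, C, hc, hC, fun n hn => ?_⟩
  obtain ⟨h₁, h₂⟩ := hcC n hn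
  exact ⟨(le_div_iff₀ (pow_pos hb n)).1 h₁, (div_le_iff₀ (pow_pos hb n)).1 h₂⟩

end BallsIntoBins

theorem theorem1 :
    (∀ (d : ℕ) (α : ℝ), (d : ℝ) < α →
      (∃! lam : ℝ, BallsIntoBins.IsTuned α d lam) ∧
      ∀ lam : ℝ, BallsIntoBins.IsTuned α d lam →
        ∃ c C : ℝ, 0 < c ∧ 0 < C ∧ ∀ n : ℕ, 1 ≤ n →
          c * BallsIntoBins.base α d lam ^ n
              ≤ BallsIntoBins.probAllLoaded ⌊α * (n : ℝ)⌋₊ n d ∧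
          BallsIntoBins.probAllLoaded ⌊α * (n : ℝ)⌋₊ n d
              ≤ C * BallsIntoBins.base α d lam ^ n) ∧
    (∀ lam : ℝ, BallsIntoBins.IsTuned 2 1 lam →
      |BallsIntoBins.base 2 1 lam - 0.836| < 0.0005) ∧
    (∃ c C : ℝ, 0 < c ∧ 0 < C ∧ ∀ d n : ℕ, 1 ≤ d → 1 ≤ n →
      c * (BallsIntoBins.baseExact d ^ n * √((d : ℝ) * (n : ℝ)))
          ≤ BallsIntoBins.probAllLoaded (d * n) n d ∧
      BallsIntoBins.probAllLoaded (d * n) n d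
          ≤ C * (BallsIntoBins.baseExact d ^ n * √((d : ℝ) * (n : ℝ)))) := by
  exact ⟨fun d α hα => ⟨BallsIntoBins.existsUnique_isTuned hα,
    fun lam h => BallsIntoBins.tuned_bounds hα h⟩,
    fun lam h => BallsIntoBins.base_two_one h, BallsIntoBins.exact_bounds⟩
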